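/- Let $n \ge 3$ and let $\varphi : (0,\infty) \to \mathbb{R}$ be a $C^2$ function such that $$\lim_{s\to\infty}\varphi(s)=\infty,\qquad \lim_{s\to\infty}\varphi'(s)=0,\qquad \lim_{s\to\infty}\varphi''(s)=0,$$ $$\lim_{s\to\infty}\varphi^{n-1}(s)\,\varphi'(s)=0,\qquad \lim_{s\to\infty}\varphi^{n-1}(s)\,\varphi''(s)=0,$$ where $\varphi^{n-1}$ denotes the $(n-1)$-st power of $\varphi$. Then there is a compactly supported function $u:\mathbb{R}^n\to\mathbb{R}$, depending on $\varphi$, that is twice differentiable everywhere in $\mathbb{R}^n$ (that is, $u$ is differentiable everywhere and so is its derivative $Du$) and for which $\det D^2u$ is continuous on $\mathbb{R}^n$, but $u$ is not in $C^2(\mathbb{R}^n)$. Moreover, $u$ can be chosen with bounded Hessian (all second order partial derivatives bounded on $\mathbb{R}^n$), and it can also be chosen with unbounded Hessian: for every such $n$ and $\varphi$ there exist functions $u$ of both kinds. -/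

import Mathlib

open Filter Topology

/-- The Hessian matrix `D²u(x)` of a function on Euclidean space: its `(i, j)` entry is the second
derivative of `u` at `x` in the directions of the `i`-th and `j`-th standard basis vectors, that is
`∂²u / ∂xᵢ∂xⱼ (x)` when `u` is twice differentiable. -/
noncomputable def hessianMatrix {n : ℕ} (u : EuclideanSpace ℝ (Fin n) → ℝ)
    (x : EuclideanSpace ℝ (Fin n)) : Matrix (Fin n) (Fin n) ℝ :=
  Matrix.of fun i j =>
    fderiv ℝ (fderiv ℝ u) x (EuclideanSpace.single i 1) (EuclideanSpace.single j 1)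

/-- The function is (Fréchet) differentiable everywhere, and so is its derivative. -/
def TwiceDifferentiable {n : ℕ} (u : EuclideanSpace ℝ (Fin n) → ℝ) : Prop :=
  Differentiable ℝ u ∧ Differentiable ℝ (fderiv ℝ u)

/-- All second order partial derivatives are bounded on the whole space. -/
def HasBoundedHessian {n : ℕ} (u : EuclideanSpace ℝ (Fin n) → ℝ) : Prop :=
  ∃ C : ℝ, ∀ x i j, |hessianMatrix u x i j| ≤ C

/-! The function sought is radial, `u x = F (‖x‖ ^ 2)`. With `q = ‖x‖ ^ 2`, `G = F'` and `H = F''`,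
the Hessian is `2 G I + 4 H x xᵀ`, with eigenvalue `2 G` on the complement of `x` and `2 G + 4 q H`
along `x`. Its determinant is `2 ^ n G ^ (n - 1) (G + 2 q H)`. If `G → 0` at the origin, the
tangential eigenvalues are small and can absorb a badly behaved `q H`: as `n - 1 ≥ 2`, it is enough
that `G ^ 2 * (q * H) → 0`. Yet `u` is `C²` only if `q H → 0`, and its Hessian is bounded exactly
when `q H` is. The germ `q ^ 3 sin (1 / q)` has `q H ≈ -sin (1 / q)`, bounded without limit; `q ^ 4
sin (1 / q ^ 2)` has `q H ≈ -4 q⁻¹ sin (1 / q ^ 2)`, unbounded. In both, `G = O(q)`. A cutoff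
(`exists_radialProfile`) gives compact support. -/

/-! ### Calculus of radial functions. -/

/-- The inner product of Euclidean space as a continuous bilinear map. -/
noncomputable def innerBilin (n : ℕ) :
    EuclideanSpace ℝ (Fin n) →L[ℝ] EuclideanSpace ℝ (Fin n) →L[ℝ] ℝ :=
  innerSL ℝ

@[simp]
theorem innerBilin_apply {n : ℕ} (x y : EuclideanSpace ℝ (Fin n)) :
    innerBilin n x y = inner ℝ x y := rfl

/-- The second derivative of `x ↦ F (‖x‖ ^ 2)`, where `a` and `b` stand for the first and second
derivatives of `F` at `‖x‖ ^ 2`. -/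
noncomputable def radialSecondDeriv {n : ℕ} (a b : ℝ) (x : EuclideanSpace ℝ (Fin n)) :
    EuclideanSpace ℝ (Fin n) →L[ℝ] EuclideanSpace ℝ (Fin n) →L[ℝ] ℝ :=
  (2 * a) • innerBilin n + (4 * b) • (innerBilin n x).smulRight (innerBilin n x)

theorem hasFDerivAt_radial {n : ℕ} {F : ℝ → ℝ} {a : ℝ} {x : EuclideanSpace ℝ (Fin n)}
    (hF : HasDerivAt F a (‖x‖ ^ 2)) :
    HasFDerivAt (fun x : EuclideanSpace ℝ (Fin n) => F (‖x‖ ^ 2)) ((2 * a) • innerBilin n x) x := by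
  have h := hF.comp_hasFDerivAt x (hasStrictFDerivAt_norm_sq x).hasFDerivAt
  have e : (2 * a) • innerBilin n x = a • 2 • innerSL ℝ x := by
    ext v
    simp
    ring
  rw [e]
  exact h

theorem hasFDerivAt_radial_gradient {n : ℕ} {G : ℝ → ℝ} {b : ℝ} {x : EuclideanSpace ℝ (Fin n)}
    (hG : HasDerivAt G b (‖x‖ ^ 2)) :
    HasFDerivAt (fun x : EuclideanSpace ℝ (Fin n) => (2 * G (‖x‖ ^ 2)) • innerBilin n x)
      (radialSecondDeriv (G (‖x‖ ^ 2)) b x) x := by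
  have h1 := (hasFDerivAt_radial hG).const_mul 2
  have h2 := (innerBilin n).hasFDerivAt (x := x)
  have h := h1.smul h2
  have e : radialSecondDeriv (G (‖x‖ ^ 2)) b x = (2 * G (‖x‖ ^ 2)) • innerBilin n +
      ((2 : ℝ) • (2 * b) • innerBilin n x).smulRight (innerBilin n x) := by
    ext v w
    simp [radialSecondDeriv]
    ring
  rw [e]
  exact h

/-- No derivative of `G` at `0` is needed: the gradient is an `o(1)` scalar times a linear map,
hence `o(‖x‖)`. -/
theorem hasFDerivAt_radial_gradient_zero {n : ℕ} {G : ℝ → ℝ} (h0 : G 0 = 0)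
    (hG : ContinuousAt G 0) :
    HasFDerivAt (fun x : EuclideanSpace ℝ (Fin n) => (2 * G (‖x‖ ^ 2)) • innerBilin n x)
      (0 : EuclideanSpace ℝ (Fin n) →L[ℝ] EuclideanSpace ℝ (Fin n) →L[ℝ] ℝ) 0 := by
  rw [hasFDerivAt_iff_isLittleO_nhds_zero]
  have hc : Tendsto (fun x : EuclideanSpace ℝ (Fin n) => 2 * G (‖x‖ ^ 2)) (𝓝 0) (𝓝 0) := by
    have hq : Tendsto (fun x : EuclideanSpace ℝ (Fin n) => ‖x‖ ^ 2) (𝓝 0) (𝓝 0) := by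
      have : Continuous (fun x : EuclideanSpace ℝ (Fin n) => ‖x‖ ^ 2) := by fun_prop
      simpa using this.tendsto 0
    have hG' : Tendsto G (𝓝 0) (𝓝 0) := by simpa [ContinuousAt, h0] using hG
    simpa using (hG'.comp hq).const_mul 2
  have h := ((Asymptotics.isLittleO_one_iff ℝ).2 hc).smul_isBigO ((innerBilin n).isBigO_id (𝓝 0))
  simpa [h0] using h

/-- The determinant is the characteristic polynomial of a rank-one matrix, evaluated at `a`. -/
theorem det_smul_one_add_smul_vecMulVec {n : ℕ} (hn : 1 ≤ n) (a b : ℝ) (x : Fin n → ℝ) :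
    (a • (1 : Matrix (Fin n) (Fin n) ℝ) + b • Matrix.vecMulVec x x).det =
      a ^ (n - 1) * (a + b * (x ⬝ᵥ x)) := by
  have h := congrArg (Polynomial.eval a) (Matrix.charpoly_vecMulVec (-(b • x)) x)
  rw [Matrix.eval_charpoly] at h
  obtain ⟨m, rfl⟩ := Nat.exists_eq_add_of_le' hn
  have e : a • (1 : Matrix (Fin (m + 1)) (Fin (m + 1)) ℝ) + b • Matrix.vecMulVec x x =
      Matrix.scalar (Fin (m + 1)) a - Matrix.vecMulVec (-(b • x)) x := by
    rw [Matrix.neg_vecMulVec, sub_neg_eq_add, Matrix.smul_vecMulVec, Matrix.smul_one_eq_diagonal]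
    rfl
  rw [e, h]
  simp
  ring

/-! ### Hessian, determinant and regularity of a radial profile. -/

/-- The data of a radial profile `F` with first derivative `G` and second derivative `H`, where `H`
may be singular at the origin. -/
structure RadialProfile (F G H : ℝ → ℝ) : Prop where
  hasDerivAt : ∀ q, HasDerivAt F (G q) q
  hasDerivAt_deriv : ∀ q, q ≠ 0 → HasDerivAt G (H q) q
  continuousAt_second : ∀ q, q ≠ 0 → ContinuousAt H q
  deriv_zero : G 0 = 0
  continuousAt_deriv : ContinuousAt G 0
  tendsto_det : Tendsto (fun q => G q ^ 2 * (q * H q)) (𝓝 0) (𝓝 0)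
  hasCompactSupport : HasCompactSupport F

namespace RadialProfile

variable {n : ℕ} {F G H : ℝ → ℝ}

theorem continuous_deriv (h : RadialProfile F G H) : Continuous G := by
  refine continuous_iff_continuousAt.2 fun q => ?_
  rcases eq_or_ne q 0 with rfl | hq
  · exact h.continuousAt_deriv
  · exact (h.hasDerivAt_deriv q hq).continuousAt

theorem fderiv_radial (h : RadialProfile F G H) :
    fderiv ℝ (fun x : EuclideanSpace ℝ (Fin n) => F (‖x‖ ^ 2)) =
      fun x => (2 * G (‖x‖ ^ 2)) • innerBilin n x :=
  funext fun x => (hasFDerivAt_radial (h.hasDerivAt _)).fderiv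

theorem hasFDerivAt_fderiv (h : RadialProfile F G H) (x : EuclideanSpace ℝ (Fin n)) :
    HasFDerivAt (fderiv ℝ (fun x : EuclideanSpace ℝ (Fin n) => F (‖x‖ ^ 2)))
      (radialSecondDeriv (G (‖x‖ ^ 2)) (H (‖x‖ ^ 2)) x) x := by
  rw [h.fderiv_radial]
  rcases eq_or_ne x 0 with rfl | hx
  -- The arbitrary value `H 0` is harmless, since it multiplies a form that vanishes at `x = 0`.
  · have e : radialSecondDeriv (G (‖(0 : EuclideanSpace ℝ (Fin n))‖ ^ 2))
        (H (‖(0 : EuclideanSpace ℝ (Fin n))‖ ^ 2)) (0 : EuclideanSpace ℝ (Fin n)) = 0 := by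
      ext v w
      simp [radialSecondDeriv, h.deriv_zero]
    rw [e]
    exact hasFDerivAt_radial_gradient_zero h.deriv_zero h.continuousAt_deriv
  · exact hasFDerivAt_radial_gradient (h.hasDerivAt_deriv _ (by simpa using hx))

theorem twiceDifferentiable (h : RadialProfile F G H) :
    TwiceDifferentiable (fun x : EuclideanSpace ℝ (Fin n) => F (‖x‖ ^ 2)) :=
  ⟨fun _ => (hasFDerivAt_radial (h.hasDerivAt _)).differentiableAt,
    fun x => (h.hasFDerivAt_fderiv x).differentiableAt⟩

theorem hessianMatrix_radial (h : RadialProfile F G H) (x : EuclideanSpace ℝ (Fin n)) :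
    hessianMatrix (fun x : EuclideanSpace ℝ (Fin n) => F (‖x‖ ^ 2)) x =
      (2 * G (‖x‖ ^ 2)) • (1 : Matrix (Fin n) (Fin n) ℝ) +
        (4 * H (‖x‖ ^ 2)) • Matrix.vecMulVec x.ofLp x.ofLp := by
  ext i j
  rw [hessianMatrix, Matrix.of_apply, (h.hasFDerivAt_fderiv x).fderiv]
  simp [radialSecondDeriv, Matrix.vecMulVec_apply, Matrix.one_apply, 
    EuclideanSpace.inner_single_right, eq_comm]

theorem continuous_mul_second (h : RadialProfile F G H) :
    Continuous (fun q => G q ^ 2 * (q * H q)) := by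
  refine continuous_iff_continuousAt.2 fun q => ?_
  rcases eq_or_ne q 0 with rfl | hq
  · simpa [ContinuousAt] using h.tendsto_det
  · exact (h.continuous_deriv.continuousAt.pow 2).mul
      (continuousAt_id.mul (h.continuousAt_second q hq))

/-- This is where `3 ≤ n` enters: the factor `G ^ (n - 1)` contains the `G ^ 2` that tames `q H`. -/
theorem continuous_det_hessianMatrix (h : RadialProfile F G H) (hn : 3 ≤ n) :
    Continuous fun x => (hessianMatrix
      (fun x : EuclideanSpace ℝ (Fin n) => F (‖x‖ ^ 2)) x).det := by
  obtain ⟨m, rfl⟩ := Nat.exists_eq_add_of_le' hn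
  have hG := h.continuous_deriv
  have hH := h.continuous_mul_second
  have e : (fun x => (hessianMatrix
      (fun x : EuclideanSpace ℝ (Fin (m + 3)) => F (‖x‖ ^ 2)) x).det) =
      (fun q => 2 ^ (m + 3) * G q ^ (m + 3) +
        2 ^ (m + 4) * (G q ^ m * (G q ^ 2 * (q * H q)))) ∘ fun x => ‖x‖ ^ 2 := by
    funext x
    have hx : x.ofLp ⬝ᵥ x.ofLp = ‖x‖ ^ 2 := by
      rw [EuclideanSpace.real_norm_sq_eq]
      simp [dotProduct, sq]
    rw [h.hessianMatrix_radial, det_smul_one_add_smul_vecMulVec (by omega), hx,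
      show m + 3 - 1 = m + 2 by omega]
    simp only [Function.comp]
    ring
  rw [e]
  exact ((continuous_const.mul (hG.pow _)).add
    (continuous_const.mul ((hG.pow _).mul hH))).comp (continuous_norm.pow 2)

theorem hasCompactSupport_radial (h : RadialProfile F G H) :
    HasCompactSupport (fun x : EuclideanSpace ℝ (Fin n) => F (‖x‖ ^ 2)) := by
  obtain ⟨R, hR⟩ := h.hasCompactSupport.isCompact.isBounded.subset_closedBall 0
  refine HasCompactSupport.intro (isCompact_closedBall 0 (|R| + 1)) fun x hx => ?_
  by_contra hne
  have h1 := hR (subset_tsupport F hne)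
  simp only [Metric.mem_closedBall, dist_zero_right, not_le, norm_pow, norm_norm] at h1 hx
  nlinarith [le_abs_self R, abs_nonneg R]

/-- The second radial derivative `2 G + 4 q H` is a diagonal entry of the Hessian matrix. -/
theorem hessianMatrix_single (h : RadialProfile F G H) (i : Fin n) {q : ℝ} (hq : 0 ≤ q) :
    hessianMatrix (fun x : EuclideanSpace ℝ (Fin n) => F (‖x‖ ^ 2))
      (EuclideanSpace.single i (√q)) i i = 2 * G q + 4 * (q * H q) := by
  rw [h.hessianMatrix_radial]
  simp [Matrix.vecMulVec_apply, Real.sq_sqrt hq]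
  rw [Real.mul_self_sqrt hq]
  ring

/-- This is the obstruction to `C²`: the radial entry `2 G + 4 q H` would be continuous along an
axis, with value `0` at the origin. -/
theorem tendsto_mul_second_of_contDiff (h : RadialProfile F G H) (i : Fin n)
    (hu : ContDiff ℝ 2 (fun x : EuclideanSpace ℝ (Fin n) => F (‖x‖ ^ 2))) :
    Tendsto (fun q => q * H q) (𝓝[>] 0) (𝓝 0) := by
  have h1 : Continuous (fderiv ℝ (fderiv ℝ
      (fun x : EuclideanSpace ℝ (Fin n) => F (‖x‖ ^ 2)))) :=
    (hu.fderiv_right (m := 1) (by norm_num)).continuous_fderiv (by norm_num)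
  have h2 : Continuous fun q : ℝ => hessianMatrix
      (fun x : EuclideanSpace ℝ (Fin n) => F (‖x‖ ^ 2)) (EuclideanSpace.single i (√q)) i i := by
    have h3 : Continuous fun q : ℝ => (EuclideanSpace.single i (√q) : EuclideanSpace ℝ (Fin n)) :=
      (PiLp.continuous_toLp 2 _).comp ((continuous_single i).comp Real.continuous_sqrt)
    simp only [hessianMatrix, Matrix.of_apply]
    exact ((h1.comp h3).clm_apply continuous_const).clm_apply continuous_const
  have h4 : Tendsto (fun q : ℝ => 1 / 4 * (hessianMatrix
      (fun x : EuclideanSpace ℝ (Fin n) => F (‖x‖ ^ 2)) (EuclideanSpace.single i (√q)) i i -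
        2 * G q)) (𝓝[>] 0) (𝓝 0) := by
    have h5 : Continuous fun q : ℝ => 1 / 4 * (hessianMatrix
        (fun x : EuclideanSpace ℝ (Fin n) => F (‖x‖ ^ 2)) (EuclideanSpace.single i (√q)) i i -
          2 * G q) :=
      continuous_const.mul (h2.sub (continuous_const.mul h.continuous_deriv))
    have h6 := h5.tendsto 0
    rw [h.hessianMatrix_single i le_rfl] at h6
    simpa [h.deriv_zero] using h6.mono_left (nhdsWithin_le_nhds (s := Set.Ioi 0))
  refine h4.congr' ?_
  filter_upwards [self_mem_nhdsWithin] with q hq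
  rw [h.hessianMatrix_single i (le_of_lt hq)]
  ring

theorem exists_bound_deriv (h : RadialProfile F G H) : ∃ C, ∀ q, |G q| ≤ C := by
  have e : G = deriv F := funext fun q => (h.hasDerivAt q).deriv.symm
  obtain ⟨C, hC⟩ := h.continuous_deriv.bounded_above_of_compact_support
    (e ▸ h.hasCompactSupport.deriv)
  exact ⟨C, hC⟩

/-- `G` is bounded, being continuous with compact support. The rest of each entry is controlled by
`|x i * x j| ≤ ‖x‖ ^ 2`, and the radial entry gives the converse. -/
theorem hasBoundedHessian_iff (h : RadialProfile F G H) (hn : 1 ≤ n) :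
    HasBoundedHessian (fun x : EuclideanSpace ℝ (Fin n) => F (‖x‖ ^ 2)) ↔
      ∃ C, ∀ q, 0 < q → |q * H q| ≤ C := by
  obtain ⟨C, hC⟩ := h.exists_bound_deriv
  constructor
  · rintro ⟨K, hK⟩
    refine ⟨(K + 2 * C) / 4, fun q hq => ?_⟩
    have h1 := hK (EuclideanSpace.single ⟨0, hn⟩ (√q)) ⟨0, hn⟩ ⟨0, hn⟩
    rw [h.hessianMatrix_single _ hq.le] at h1
    have h2 := hC q
    rw [abs_le] at *
    constructor <;> linarith
  · rintro ⟨K, hK⟩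
    refine ⟨2 * C + 4 * K, fun x i j => ?_⟩
    have hK0 : 0 ≤ K := (abs_nonneg _).trans (hK 1 one_pos)
    rw [h.hessianMatrix_radial]
    have h1 : |H (‖x‖ ^ 2) * (x i * x j)| ≤ K := by
      rcases eq_or_ne x 0 with rfl | hx
      · simpa using hK0
      · refine le_trans ?_ (hK (‖x‖ ^ 2) (by positivity))
        rw [abs_mul, abs_mul, abs_mul, mul_comm, abs_of_nonneg (sq_nonneg ‖x‖), sq]
        gcongr
        · exact PiLp.norm_apply_le x i
        · exact PiLp.norm_apply_le x j
    have h2 : |G (‖x‖ ^ 2) * (1 : Matrix (Fin n) (Fin n) ℝ) i j| ≤ C := by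
      refine le_trans ?_ (hC (‖x‖ ^ 2))
      rw [abs_mul]
      refine mul_le_of_le_one_right (abs_nonneg _) ?_
      rw [Matrix.one_apply]
      split_ifs <;> simp
    simp only [Matrix.add_apply, Matrix.smul_apply, Matrix.vecMulVec_apply, smul_eq_mul]
    rw [abs_le] at *
    constructor <;> linarith

/-- Only the behaviour near `0` matters: `q H` is continuous on a compact interval away from `0` and
vanishes beyond the support of `F`. -/
theorem exists_bound_mul_second (h : RadialProfile F G H) {K : ℝ}
    (hK : ∀ᶠ q in 𝓝[>] 0, |q * H q| ≤ K) : ∃ C, ∀ q, 0 < q → |q * H q| ≤ C := by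
  obtain ⟨R, hR⟩ := h.hasCompactSupport.isCompact.isBounded.subset_closedBall 0
  obtain ⟨δ, hδ, hKδ⟩ := mem_nhdsGT_iff_exists_Ioo_subset.1 hK
  have hc : ContinuousOn (fun q => q * H q) (Set.Icc δ R) := fun q hq =>
    (continuousAt_id.mul (h.continuousAt_second q
      (lt_of_lt_of_le hδ hq.1).ne')).continuousWithinAt
  obtain ⟨C, hC⟩ := isCompact_Icc.exists_bound_of_continuousOn hc
  refine ⟨max (max K C) 0, fun q hq => ?_⟩
  rcases lt_or_ge q δ with h1 | h1
  · exact (hKδ ⟨hq, h1⟩).trans ((le_max_left _ _).trans (le_max_left _ _))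
  rcases le_or_gt q R with h2 | h2
  · exact (hC q ⟨h1, h2⟩).trans ((le_max_right _ _).trans (le_max_left _ _))
  have hF0 : F =ᶠ[𝓝 q] 0 := by
    rw [← notMem_tsupport_iff_eventuallyEq]
    intro hq'
    have h3 := hR hq'
    rw [Metric.mem_closedBall, dist_zero_right, Real.norm_eq_abs] at h3
    linarith [le_abs_self q]
  have e : G = deriv F := funext fun q => (h.hasDerivAt q).deriv.symm
  have hH0 : H q = 0 := by
    rw [← (h.hasDerivAt_deriv q hq.ne').deriv, e, hF0.deriv.deriv_eq]
    simp [Pi.zero_def]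
  simp [hH0]

end RadialProfile

/-! ### Cutoff and the two oscillating germs. -/

/-- Multiplying an oscillating germ `P` by a cutoff yields a radial profile whose derivatives agree
with those of `P` near the origin. -/
theorem exists_radialProfile {P A B : ℝ → ℝ} (hP : ∀ q, q ≠ 0 → ContDiffAt ℝ 2 P q)
    (hA : ∀ q, q ≠ 0 → HasDerivAt P (A q) q) (hB : ∀ q, q ≠ 0 → HasDerivAt A (B q) q)
    (hA0 : A 0 = 0) (hP0 : HasDerivAt P 0 0) (hAc : ContinuousAt A 0)
    (hAB : Tendsto (fun q => A q ^ 2 * (q * B q)) (𝓝 0) (𝓝 0)) :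
    ∃ F G H : ℝ → ℝ, RadialProfile F G H ∧
      (fun q => q * H q) =ᶠ[𝓝 0] fun q => q * B q := by
  let χ : ContDiffBump (0 : ℝ) := ⟨1, 2, one_pos, one_lt_two⟩
  have hA' : ∀ q, HasDerivAt P (A q) q := fun q => by
    rcases eq_or_ne q 0 with rfl | hq
    · rwa [hA0]
    · exact hA q hq
  let F : ℝ → ℝ := fun q => χ q * P q
  have hFP : F =ᶠ[𝓝 0] P := by
    filter_upwards [χ.eventuallyEq_one] with q hq
    simp [F, hq]
  have hF : ∀ q, q ≠ 0 → ContDiffAt ℝ 2 F q := fun q hq => χ.contDiffAt.mul (hP q hq)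
  have hGA : deriv F =ᶠ[𝓝 0] A :=
    hFP.deriv.trans (Eventually.of_forall fun q => (hA' q).deriv)
  have hHB : (fun q => q * deriv (deriv F) q) =ᶠ[𝓝 0] fun q => q * B q := by
    filter_upwards [hGA.deriv] with q hq
    rcases eq_or_ne q 0 with rfl | hq0
    · simp
    · rw [hq, (hB q hq0).deriv]
  have hG : ∀ q, q ≠ 0 → ContDiffAt ℝ 1 (deriv F) q := fun q hq =>
    ((hF q hq).fderiv_right (m := 1) (by norm_num)).clm_apply contDiffAt_const
  refine ⟨F, deriv F, deriv (deriv F), ⟨fun q => ?_, fun q hq => ?_, fun q hq => ?_, ?_, ?_, ?_, ?_⟩, hHB⟩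
  · exact (χ.contDiff.differentiable (n := 1) (by norm_num) q |>.mul
      (hA' q).differentiableAt).hasDerivAt
  · exact ((hG q hq).differentiableAt (by norm_num)).hasDerivAt
  · exact (((hG q hq).fderiv_right (m := 0) (by norm_num)).clm_apply contDiffAt_const).continuousAt
  · rw [hGA.self_of_nhds, hA0]
  · exact hAc.congr hGA.symm
  · refine hAB.congr' ?_
    filter_upwards [hGA, hHB] with q h1 h2
    rw [h1, h2]
  · exact χ.hasCompactSupport.mul_right

theorem tendsto_mul_of_abs_le {f g : ℝ → ℝ} {C : ℝ} (hf : Tendsto f (𝓝 0) (𝓝 0))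
    (hg : ∀ q, |g q| ≤ C) : Tendsto (fun q => f q * g q) (𝓝 0) (𝓝 0) :=
  hf.zero_mul_isBoundedUnder_le (isBoundedUnder_of ⟨C, hg⟩)

/-- The arguments at which the sine is one. -/
noncomputable def sinePeak (k : ℕ) : ℝ := Real.pi / 2 + k * (2 * Real.pi)

theorem sin_sinePeak (k : ℕ) : Real.sin (sinePeak k) = 1 := by
  rw [sinePeak, Real.sin_add_nat_mul_two_pi, Real.sin_pi_div_two]

theorem cos_sinePeak (k : ℕ) : Real.cos (sinePeak k) = 0 := by
  rw [sinePeak, Real.cos_add_nat_mul_two_pi, Real.cos_pi_div_two]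

theorem sinePeak_pos (k : ℕ) : 0 < sinePeak k := by
  have := Real.pi_pos
  unfold sinePeak
  positivity

theorem tendsto_sinePeak : Tendsto sinePeak atTop atTop :=
  tendsto_atTop_add_const_left _ _
    (tendsto_natCast_atTop_atTop.atTop_mul_const (by positivity))

/-- The oscillating germ `q ^ 3 * sin (1 / q)`. -/
theorem exists_radialProfile_inv : ∃ F G H : ℝ → ℝ, RadialProfile F G H ∧
    (fun q => q * H q) =ᶠ[𝓝 0]
      fun q => 6 * q ^ 2 * Real.sin q⁻¹ - 4 * q * Real.cos q⁻¹ - Real.sin q⁻¹ := by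
  have hs (q : ℝ) : |Real.sin q⁻¹| ≤ 1 := Real.abs_sin_le_one _
  have hc (q : ℝ) : |Real.cos q⁻¹| ≤ 1 := Real.abs_cos_le_one _
  have t1 : Tendsto (fun q : ℝ => q * Real.cos q⁻¹) (𝓝 0) (𝓝 0) :=
    tendsto_mul_of_abs_le tendsto_id hc
  have t2 : Tendsto (fun q : ℝ => q ^ 2 * Real.sin q⁻¹) (𝓝 0) (𝓝 0) :=
    tendsto_mul_of_abs_le (by simpa using (continuous_pow 2).tendsto (0 : ℝ)) hs
  have tA : Tendsto (fun q : ℝ => 3 * (q ^ 2 * Real.sin q⁻¹) - q * Real.cos q⁻¹) (𝓝 0) (𝓝 0) := by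
    simpa using (t2.const_mul 3).sub t1
  have tA2 : Tendsto (fun q : ℝ => (3 * (q ^ 2 * Real.sin q⁻¹) - q * Real.cos q⁻¹) ^ 2)
      (𝓝 0) (𝓝 0) := by
    simpa using tA.pow 2
  have dS : ∀ q : ℝ, q ≠ 0 → HasDerivAt (fun q => Real.sin q⁻¹)
      (Real.cos q⁻¹ * (-(q ^ 2)⁻¹)) q := fun q hq => (hasDerivAt_inv hq).sin
  have dC : ∀ q : ℝ, q ≠ 0 → HasDerivAt (fun q => Real.cos q⁻¹)
      (-Real.sin q⁻¹ * (-(q ^ 2)⁻¹)) q := fun q hq => (hasDerivAt_inv hq).cos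
  have hqB : ∀ q : ℝ, q * (6 * q * Real.sin q⁻¹ - 4 * Real.cos q⁻¹ - q⁻¹ * Real.sin q⁻¹) =
      6 * q ^ 2 * Real.sin q⁻¹ - 4 * q * Real.cos q⁻¹ - Real.sin q⁻¹ := fun q => by
    rcases eq_or_ne q 0 with rfl | hq
    · simp
    · field_simp
  obtain ⟨F, G, H, h, hH⟩ := exists_radialProfile (P := fun q => q ^ 3 * Real.sin q⁻¹)
    (A := fun q => 3 * (q ^ 2 * Real.sin q⁻¹) - q * Real.cos q⁻¹)
    (B := fun q => 6 * q * Real.sin q⁻¹ - 4 * Real.cos q⁻¹ - q⁻¹ * Real.sin q⁻¹)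
    (fun q hq => (contDiffAt_id.pow 3).mul (contDiffAt_inv ℝ hq).sin)
    (fun q hq => by
      convert! (hasDerivAt_pow 3 q).mul (dS q hq) using 1
      field_simp
      ring)
    (fun q hq => by
      convert! (((hasDerivAt_pow 2 q).mul (dS q hq)).const_mul 3).sub
        ((hasDerivAt_id q).mul (dC q hq)) using 1
      simp
      field_simp
      ring)
    (by simp)
    (by
      rw [hasDerivAt_iff_tendsto_slope]
      refine (t2.mono_left nhdsWithin_le_nhds).congr' ?_
      filter_upwards [self_mem_nhdsWithin] with q hq
      have hq' : q ≠ 0 := hq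
      simp [slope_def_field]
      field_simp)
    (by simpa [ContinuousAt] using tA)
    (by
      simp only [hqB]
      have h1 : Tendsto (fun q : ℝ => 6 * (q ^ 2 * Real.sin q⁻¹) - 4 * (q * Real.cos q⁻¹))
          (𝓝 0) (𝓝 0) := by
        simpa using (t2.const_mul 6).sub (t1.const_mul 4)
      -- `q B` is a null term `h1` minus a bounded sine, and `A ^ 2 → 0` kills both.
      have h2 := (tA2.mul h1).sub (tendsto_mul_of_abs_le tA2 hs)
      simp only [mul_zero, sub_zero] at h2
      refine h2.congr fun q => ?_
      ring)
  exact ⟨F, G, H, h, hH.trans (Eventually.of_forall hqB)⟩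

/-- The oscillating germ `q ^ 4 * sin (1 / q ^ 2)`. -/
theorem exists_radialProfile_inv_sq : ∃ F G H : ℝ → ℝ, RadialProfile F G H ∧
    (fun q => q * H q) =ᶠ[𝓝 0] fun q => 12 * q ^ 3 * Real.sin (q ^ 2)⁻¹ -
      10 * q * Real.cos (q ^ 2)⁻¹ - 4 * q⁻¹ * Real.sin (q ^ 2)⁻¹ := by
  have hs (q : ℝ) : |Real.sin (q ^ 2)⁻¹| ≤ 1 := Real.abs_sin_le_one _
  have hc (q : ℝ) : |Real.cos (q ^ 2)⁻¹| ≤ 1 := Real.abs_cos_le_one _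
  have t1 : Tendsto (fun q : ℝ => q * Real.cos (q ^ 2)⁻¹) (𝓝 0) (𝓝 0) :=
    tendsto_mul_of_abs_le tendsto_id hc
  have t2 : Tendsto (fun q : ℝ => q ^ 2 * Real.sin (q ^ 2)⁻¹) (𝓝 0) (𝓝 0) :=
    tendsto_mul_of_abs_le (by simpa using (continuous_pow 2).tendsto (0 : ℝ)) hs
  have t3 : Tendsto (fun q : ℝ => q ^ 3 * Real.sin (q ^ 2)⁻¹) (𝓝 0) (𝓝 0) :=
    tendsto_mul_of_abs_le (by simpa using (continuous_pow 3).tendsto (0 : ℝ)) hs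
  have tA : Tendsto (fun q : ℝ => 4 * (q ^ 3 * Real.sin (q ^ 2)⁻¹) -
      2 * (q * Real.cos (q ^ 2)⁻¹)) (𝓝 0) (𝓝 0) := by
    simpa using (t3.const_mul 4).sub (t1.const_mul 2)
  have dI : ∀ q : ℝ, q ≠ 0 → HasDerivAt (fun q : ℝ => (q ^ 2)⁻¹) (-2 * (q ^ 3)⁻¹) q :=
    fun q hq => by
      convert! (hasDerivAt_pow 2 q).inv (pow_ne_zero 2 hq) using 1
      field_simp
      norm_num
  have dS : ∀ q : ℝ, q ≠ 0 → HasDerivAt (fun q => Real.sin (q ^ 2)⁻¹)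
      (Real.cos (q ^ 2)⁻¹ * (-2 * (q ^ 3)⁻¹)) q := fun q hq => (dI q hq).sin
  have dC : ∀ q : ℝ, q ≠ 0 → HasDerivAt (fun q => Real.cos (q ^ 2)⁻¹)
      (-Real.sin (q ^ 2)⁻¹ * (-2 * (q ^ 3)⁻¹)) q := fun q hq => (dI q hq).cos
  have hqB : ∀ q : ℝ, q * (12 * q ^ 2 * Real.sin (q ^ 2)⁻¹ - 10 * Real.cos (q ^ 2)⁻¹ -
      4 * (q ^ 2)⁻¹ * Real.sin (q ^ 2)⁻¹) = 12 * q ^ 3 * Real.sin (q ^ 2)⁻¹ -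
      10 * q * Real.cos (q ^ 2)⁻¹ - 4 * q⁻¹ * Real.sin (q ^ 2)⁻¹ := fun q => by
    rcases eq_or_ne q 0 with rfl | hq
    · simp
    · field_simp
  obtain ⟨F, G, H, h, hH⟩ := exists_radialProfile (P := fun q => q ^ 4 * Real.sin (q ^ 2)⁻¹)
    (A := fun q => 4 * (q ^ 3 * Real.sin (q ^ 2)⁻¹) - 2 * (q * Real.cos (q ^ 2)⁻¹))
    (B := fun q => 12 * q ^ 2 * Real.sin (q ^ 2)⁻¹ - 10 * Real.cos (q ^ 2)⁻¹ -
      4 * (q ^ 2)⁻¹ * Real.sin (q ^ 2)⁻¹)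
    (fun q hq => (contDiffAt_id.pow 4).mul
      ((contDiffAt_id.pow 2).inv (pow_ne_zero 2 hq)).sin)
    (fun q hq => by
      convert! (hasDerivAt_pow 4 q).mul (dS q hq) using 1
      field_simp
      ring)
    (fun q hq => by
      convert! (((hasDerivAt_pow 3 q).mul (dS q hq)).const_mul 4).sub
        (((hasDerivAt_id q).mul (dC q hq)).const_mul 2) using 1
      simp
      field_simp
      ring)
    (by simp)
    (by
      rw [hasDerivAt_iff_tendsto_slope]
      refine (t3.mono_left nhdsWithin_le_nhds).congr' ?_
      filter_upwards [self_mem_nhdsWithin] with q hq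
      have hq' : q ≠ 0 := hq
      simp [slope_def_field]
      field_simp)
    (by simpa [ContinuousAt] using tA)
    (by
      simp only [hqB]
      have h1 : Tendsto (fun q : ℝ => 12 * (q ^ 3 * Real.sin (q ^ 2)⁻¹) -
          10 * (q * Real.cos (q ^ 2)⁻¹)) (𝓝 0) (𝓝 0) := by
        simpa using (t3.const_mul 12).sub (t1.const_mul 10)
      -- In the singular term `A ^ 2 * 4 q⁻¹ sin`, one factor `A` cancels `q⁻¹`: for `q ≠ 0`, `A * 4
      -- q⁻¹ = 16 q ^ 2 sin - 8 cos`. The other `A` tends to `0`; `h2` and `h3` treat the two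
      -- pieces.
      have h2 := tendsto_mul_of_abs_le (by simpa using tA.mul_const 8) fun q =>
        (abs_mul _ _).trans_le (mul_le_one₀ (hc q) (abs_nonneg _) (hs q))
      have h3 := tendsto_mul_of_abs_le (by simpa using tA.mul (t2.const_mul 16)) hs
      have h4 := (((tA.pow 2).mul h1).sub h3).add h2
      simp only [mul_zero, sub_zero, add_zero] at h4
      refine h4.congr fun q => ?_
      rcases eq_or_ne q 0 with rfl | hq
      · simp
      · field_simp
        ring)
  exact ⟨F, G, H, h, hH.trans (Eventually.of_forall hqB)⟩

/-! ### The two examples. -/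

theorem exists_radial_boundedHessian {n : ℕ} (hn : 3 ≤ n) :
    ∃ u : EuclideanSpace ℝ (Fin n) → ℝ,
      HasCompactSupport u ∧ TwiceDifferentiable u ∧
        Continuous (fun x => (hessianMatrix u x).det) ∧ ¬ ContDiff ℝ 2 u ∧
        HasBoundedHessian u := by
  obtain ⟨F, G, H, h, hH⟩ := exists_radialProfile_inv
  refine ⟨_, h.hasCompactSupport_radial, h.twiceDifferentiable,
    h.continuous_det_hessianMatrix hn, fun hu => ?_,
    (h.hasBoundedHessian_iff (by omega)).2 (h.exists_bound_mul_second (K := 11) ?_)⟩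
  · have h1 := (h.tendsto_mul_second_of_contDiff ⟨0, by omega⟩ hu).congr'
      (hH.filter_mono nhdsWithin_le_nhds)
    -- Along `q = 1 / sinePeak k` the cosine vanishes and the sine is `1`, so `q H = 6 q ^ 2 - 1 →
    -- -1`, not `0`.
    have h2 := h1.comp (tendsto_inv_atTop_nhdsGT_zero.comp tendsto_sinePeak)
    have h3 : Tendsto (fun k => 6 * (sinePeak k)⁻¹ ^ 2 - 1) atTop (𝓝 (6 * 0 ^ 2 - 1)) :=
      (((tendsto_inv_atTop_zero.comp tendsto_sinePeak).pow 2).const_mul 6).sub_const 1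
    have h4 := tendsto_nhds_unique h2 (h3.congr fun k => by
      simp [sin_sinePeak, cos_sinePeak])
    norm_num at h4
  -- For `0 < q < 1` the three terms are at most `6`, `4` and `1`, whence `K = 11`.
  · filter_upwards [hH.filter_mono nhdsWithin_le_nhds, Ioo_mem_nhdsGT one_pos] with q hq hq1
    rw [hq]
    have h1 := Real.abs_sin_le_one q⁻¹
    have h2 := Real.abs_cos_le_one q⁻¹
    have h3 : |6 * q ^ 2 * Real.sin q⁻¹| ≤ 6 := by
      rw [abs_mul, abs_of_nonneg (by positivity)]
      nlinarith [hq1.1, hq1.2, abs_nonneg (Real.sin q⁻¹), sq_nonneg q]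
    have h4 : |4 * q * Real.cos q⁻¹| ≤ 4 := by
      rw [abs_mul, abs_of_nonneg (by linarith [hq1.1])]
      nlinarith [hq1.1, hq1.2, abs_nonneg (Real.cos q⁻¹)]
    rw [abs_le] at *
    constructor <;> linarith

theorem exists_radial_unboundedHessian {n : ℕ} (hn : 3 ≤ n) :
    ∃ u : EuclideanSpace ℝ (Fin n) → ℝ,
      HasCompactSupport u ∧ TwiceDifferentiable u ∧
        Continuous (fun x => (hessianMatrix u x).det) ∧ ¬ ContDiff ℝ 2 u ∧
        ¬ HasBoundedHessian u := by
  obtain ⟨F, G, H, h, hH⟩ := exists_radialProfile_inv_sq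
  -- At `q = 1 / √(sinePeak k)` the argument `1 / q ^ 2` is a sine peak, so eventually `q H = 12 q ^
  -- 3 - 4 / q`, which tends to `-∞`. This rules out both `C²` and a bounded Hessian.
  have hθ : Tendsto (fun k => √(sinePeak k)) atTop atTop :=
    Real.tendsto_sqrt_atTop.comp tendsto_sinePeak
  have hθ' : Tendsto (fun k => (√(sinePeak k))⁻¹) atTop (𝓝[>] 0) :=
    tendsto_inv_atTop_nhdsGT_zero.comp hθ
  have hlim : Tendsto (fun k => (√(sinePeak k))⁻¹ * H (√(sinePeak k))⁻¹) atTop atBot := by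
    have h1 : Tendsto (fun k => 12 * (√(sinePeak k))⁻¹ ^ 3 + -4 * √(sinePeak k)) atTop atBot :=
      (((hθ'.mono_right nhdsWithin_le_nhds).pow 3).const_mul 12).add_atBot
        (hθ.const_mul_atTop_of_neg (by norm_num))
    refine h1.congr' ?_
    filter_upwards [hθ'.eventually (hH.filter_mono nhdsWithin_le_nhds)] with k hk
    rw [hk]
    simp [Real.sq_sqrt (sinePeak_pos k).le, sin_sinePeak, cos_sinePeak]
    ring
  refine ⟨_, h.hasCompactSupport_radial, h.twiceDifferentiable,
    h.continuous_det_hessianMatrix hn, fun hu => ?_, fun hb => ?_⟩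
  · exact not_tendsto_nhds_of_tendsto_atBot hlim 0
      ((h.tendsto_mul_second_of_contDiff ⟨0, by omega⟩ hu).comp hθ')
  · obtain ⟨C, hC⟩ := (h.hasBoundedHessian_iff (by omega)).1 hb
    obtain ⟨k, hk⟩ := (hlim.eventually (eventually_lt_atBot (-C))).exists
    have := hC _ (inv_pos.2 (Real.sqrt_pos.2 (sinePeak_pos k)))
    linarith [(abs_le.1 this).1]

theorem mainTheorem3 (n : ℕ) (hn : 3 ≤ n) (φ : ℝ → ℝ)
    (hφ : ContDiffOn ℝ 2 φ (Set.Ioi 0))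
    (hφ_lim : Tendsto φ atTop atTop)
    (hφ'_lim : Tendsto (deriv φ) atTop (𝓝 0))
    (hφ''_lim : Tendsto (deriv (deriv φ)) atTop (𝓝 0))
    (hφφ' : Tendsto (fun s => φ s ^ (n - 1) * deriv φ s) atTop (𝓝 0))
    (hφφ'' : Tendsto (fun s => φ s ^ (n - 1) * deriv (deriv φ) s) atTop (𝓝 0)) :
    (∃ u : EuclideanSpace ℝ (Fin n) → ℝ,
      HasCompactSupport u ∧ TwiceDifferentiable u ∧
        Continuous (fun x => (hessianMatrix u x).det) ∧ ¬ ContDiff ℝ 2 u ∧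
        HasBoundedHessian u) ∧
    (∃ u : EuclideanSpace ℝ (Fin n) → ℝ,
      HasCompactSupport u ∧ TwiceDifferentiable u ∧
        Continuous (fun x => (hessianMatrix u x).det) ∧ ¬ ContDiff ℝ 2 u ∧
        ¬ HasBoundedHessian u) :=
  ⟨exists_radial_boundedHessian hn, exists_radial_unboundedHessian hn⟩
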